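/- Let $\Bbbk$ be a field of characteristic $0$, let $d\ge 1$ and $n_1,\dots,n_d\ge 1$, let $\mathbf r=(r_1,\dots,r_m)$ with all $r_k\ge 2$, and put $R=r_1\cdots r_m$. Let $\odot$ denote the entrywise (Hadamard) product on $\Bbbk^{n_1\times\cdots\times n_d}$, with unit the all-ones tensor $\mathbb 1$. A rank-$1$ tensor is a nonzero tensor of the form $\mathbf a_1\otimes\cdots\otimes\mathbf a_d$, $\mathcal S$ denotes the Segre variety of all tensors $\mathbf a_1\otimes\cdots\otimes\mathbf a_d$ (so $0$ is included), and the rank of a tensor is the least number of rank-$1$ tensors of which it is the sum. A tensor $\mathcal T$ is *$R$-identifiable* if it has rank $R$ and there is exactly one multiset of $R$ rank-$1$ tensors with sum $\mathcal T$. An *$\mathbf r$-Hadamard–Hitchcock decomposition* ($\mathbf r$-HHD) of $\mathcal T$ is an expression $$\mathcal T=\Big(\sum_{i=1}^{r_1}\mathcal A_{1i}\Big)\odot\cdots\odot\Big(\sum_{i=1}^{r_m}\mathcal A_{mi}\Big)$$ with all $\mathcal A_{ki}$ of rank $1$. The tensor $\mathcal T$ is *$\mathbf r$-identifiable* if it has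 an $\mathbf r$-HHD and this is unique up to (i) permuting the summands within each Hadamard factor, (ii) permuting Hadamard factors of equal length, and (iii) replacing $\mathcal A_{ki}$ by $\mathcal D_k\odot\mathcal A_{ki}$ for all $k,i$, where $\mathcal D_1,\dots,\mathcal D_m$ are rank-$1$ tensors without zero entries and $\mathcal D_1\odot\cdots\odot\mathcal D_m=\mathbb 1$. Let $\sigma_{\mathbf r}(\mathcal S)\subset\Bbbk^{n_1\times\cdots\times n_d}$ be the Zariski closure of the set of all products $\mathcal T_1\odot\cdots\odot\mathcal T_m$ with $\operatorname{rank}\mathcal T_k\le r_k$. A property holds for a *generic* point of a variety $V$ if it holds on $V\setminus Z$ for some Zariski closed subset $Z\subsetneq V$. **Theorem.** (a) Let $(\mathcal A_{ki})_{k\in[m],\,i\in[r_k]}$ be a generic point of $\mathcal S^{r_1}\times\cdots\times\mathcal S^{r_m}$, and let $\mathcal T=\big(\sum_{i}\mathcal A_{1i}\big)\odot\cdots\odot\big(\sum_{i}\mathcal A_{mi}\big)$. If $\mathcal T$ is $R$-identifiable, then $\mathcal T$ is $\mathbf r$-identifiable. (b) If $\Bbbk$ is algebraically closed, then for generic $\mathcal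 T\in\sigma_{\mathbf r}(\mathcal S)$: if $\mathcal T$ is $R$-identifiable, then $\mathcal T$ is $\mathbf r$-identifiable. -/

import Mathlib

namespace HHD

/-- Multi-indices `[n_1] × ⋯ × [n_d]`. -/
abbrev Idx {d : ℕ} (n : Fin d → ℕ) : Type := (l : Fin d) → Fin (n l)

/-- Tensors of shape `n_1 × ⋯ × n_d` in coordinates. The pointwise ring structure makes `*` the
Hadamard product and `1` the all-ones tensor. -/
abbrev Tensor (k : Type*) {d : ℕ} (n : Fin d → ℕ) : Type _ := Idx n → k

section Zariski

variable {k : Type*} [Field k] {ι : Type*}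

/-- A subset of `k^ι` is Zariski closed if it is the zero locus of an ideal of polynomials. -/
def IsZariskiClosed (Z : Set (ι → k)) : Prop :=
  ∃ I : Ideal (MvPolynomial ι k), Z = MvPolynomial.zeroLocus k I

/-- The Zariski closure in `k^ι`. -/
def zariskiClosure (V : Set (ι → k)) : Set (ι → k) :=
  MvPolynomial.zeroLocus k (MvPolynomial.vanishingIdeal k V)

/-- `P` holds for a generic point of `V`: everywhere on `V` outside some strict Zariski closed
subset `Z ⊊ V`. -/
def Generically (V : Set (ι → k)) (P : (ι → k) → Prop) : Prop :=
  ∃ Z : Set (ι → k), IsZariskiClosed Z ∧ Z ⊂ V ∧ ∀ x ∈ V \ Z, P x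

end Zariski

section Tensors

variable {k : Type*} [Field k] {d : ℕ} {n : Fin d → ℕ}

/-- The tensor product `a_1 ⊗ ⋯ ⊗ a_d`. -/
def outer (a : (l : Fin d) → Fin (n l) → k) : Tensor k n := fun j => ∏ l, a l (j l)

variable (k n) in
/-- The (affine) Segre variety: rank-one tensors together with `0`. -/
def segre : Set (Tensor k n) := Set.range outer

/-- Rank-one tensors. -/
def IsRankOne (A : Tensor k n) : Prop := A ∈ segre k n ∧ A ≠ 0

/-- Rank-one tensors without zero entries. -/
def IsNowhereZeroRankOne (D : Tensor k n) : Prop := IsRankOne D ∧ ∀ j, D j ≠ 0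

/-- The unordered decompositions of `T` as a sum of `r` rank-one tensors. -/
def cpds (r : ℕ) (T : Tensor k n) : Set (Multiset (Tensor k n)) :=
  {s | s.card = r ∧ (∀ A ∈ s, IsRankOne A) ∧ s.sum = T}

/-- The tensor rank: the least length of a decomposition into rank-one tensors. -/
noncomputable def tensorRank (T : Tensor k n) : ℕ := sInf {r | (cpds r T).Nonempty}

/-- `r`-identifiability: `T` has rank `r` and exactly one rank-`r` decomposition, up to order. -/
def IsIdentifiable (r : ℕ) (T : Tensor k n) : Prop :=
  tensorRank T = r ∧ ∃ s, cpds r T = {s}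

variable {m : ℕ}

variable (k n) in
/-- Hadamard products `T_1 * ⋯ * T_m` with `rank T_i ≤ r_i`. -/
def openHadamardSecant (r : Fin m → ℕ) : Set (Tensor k n) :=
  {T | ∃ X : Fin m → Tensor k n, (∀ i, tensorRank (X i) ≤ r i) ∧ T = ∏ i, X i}

variable (k n) in
/-- The Hadamard product of secant varieties `σ_r(S)`. -/
def hadamardSecant (r : Fin m → ℕ) : Set (Tensor k n) :=
  zariskiClosure (openHadamardSecant k n r)

/-- The `r`-HHDs of `T`: the `i`-th Hadamard factor is an unordered `r_i`-tuple of rank-one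
tensors. The order of the Hadamard factors is divided out in `essentialClass`. -/
def hhds (r : Fin m → ℕ) (T : Tensor k n) : Set (Fin m → Multiset (Tensor k n)) :=
  {H | (∀ i, (H i).card = r i ∧ ∀ A ∈ H i, IsRankOne A) ∧ T = ∏ i, (H i).sum}

/-- The class of an `r`-HHD `H` of `T`: all `r`-HHDs of `T` obtained from `H` by permuting
Hadamard factors of equal length and Hadamard multiplying the `i`-th factor by `D_i`, where the
`D_i` are nowhere zero rank-one tensors with `D_1 * ⋯ * D_m = 1`. -/
def essentialClass (r : Fin m → ℕ) (T : Tensor k n) (H : Fin m → Multiset (Tensor k n)) :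
    Set (Fin m → Multiset (Tensor k n)) :=
  {H' ∈ hhds r T | ∃ (ψ : Equiv.Perm (Fin m)) (D : Fin m → Tensor k n),
    (∀ i, r (ψ i) = r i) ∧ (∀ i, IsNowhereZeroRankOne (D i)) ∧ ∏ i, D i = 1 ∧
    ∀ i, H' (ψ i) = (H i).map (fun A => D i * A)}

/-- The set of essential `r`-HHDs of `T`. -/
def essentialHHDs (r : Fin m → ℕ) (T : Tensor k n) :
    Set (Set (Fin m → Multiset (Tensor k n))) :=
  essentialClass r T '' hhds r T

/-- `r`-identifiability for a rank vector `r`: there is exactly one essential `r`-HHD. -/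
def IsHHDIdentifiable (r : Fin m → ℕ) (T : Tensor k n) : Prop :=
  ∃ c, essentialHHDs r T = {c}

/-- Coordinates of ordered `r`-HHDs: the entry `j` of the `p.2`-th summand of the `p.1`-th
Hadamard factor has coordinate `(p, j)`. -/
abbrev OrderedIdx {d m : ℕ} (n : Fin d → ℕ) (r : Fin m → ℕ) : Type :=
  ((i : Fin m) × Fin (r i)) × Idx n

variable (k n) in
/-- The variety `S^{r_1} × ⋯ × S^{r_m}` of ordered `r`-HHDs, in the affine space of all tuples of
tensors. -/
def orderedHHDs (r : Fin m → ℕ) : Set (OrderedIdx n r → k) :=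
  {x | ∀ p, (fun j => x (p, j)) ∈ segre k n}

/-- The tensor `(∑_j A_{1j}) * ⋯ * (∑_j A_{mj})` of an ordered `r`-HHD. -/
def hhdTensor (r : Fin m → ℕ) (x : OrderedIdx n r → k) : Tensor k n :=
  ∏ i, ∑ t : Fin (r i), fun j => x (⟨i, t⟩, j)

end Tensors

end HHD

/-! Expanding an HHD gives R products of rank-one tensors, indexed by the grid of tuples `p` with `p
i : Fin (r i)`. If the tensor is R-identifiable, no product vanishes and the expansions of two HHDs
A and B agree as multisets, so B_p = A_{φ p} for a permutation φ of the grid. Exchanging one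
coordinate between p and q does not change B_p * B_q, hence not A_{φ p} * A_{φ q} either. If A
satisfies only trivial quadratic relations (`IsRelationFree`), φ must then permute the axes and
relabel each axis (`exists_axes_perm_of_swap`). Varying one coordinate at a time shows that the
factors of B are those of A up to scaling (`eq_div_mul_of_prod_eq`).

Relation-freeness holds wherever a certain polynomial is nonzero, and constant tensors with distinct
prime values show that this polynomial does not vanish identically. This gives (a). For (b),
Chevalley's theorem and the Nullstellensatz carry the open condition over to the closure of the
image (`exists_basicOpen_subset_image`). -/

namespace HHD

/-! ### Combinatorics of permutations of a grid -/

section Grid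

open Function

variable {ι : Type*} [DecidableEq ι] [Fintype ι] {X : ι → Type*}

/-- A function on a grid that does not change when a single coordinate does is constant. -/
theorem eq_of_update_eq {Y : Type*} {g : (∀ l, X l) → Y}
    (hg : ∀ p l x, g (update p l x) = g p) (p q : ∀ l, X l) : g p = g q := by
  have key : ∀ s : Finset ι, g (s.piecewise q p) = g p := by
    intro s
    induction s using Finset.induction_on with
    | empty => simp
    | insert a s _ ih => rw [Finset.piecewise_insert, hg, ih]
  simpa using (key Finset.univ).symm

/-- A function on a grid whose unordered pairs of values are unchanged by swapping a coordinate
between two points depends on a single coordinate. -/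
theorem exists_coordinate_of_swap [Nonempty ι] {Y : Type*} {g : (∀ l, X l) → Y}
    (hg : ∀ p q l, s(g p, g q) = s(g (update p l (q l)), g (update q l (p l)))) :
    ∃ l, ∀ p q, p l = q l → g p = g q := by
  by_cases hc : ∃ p l x, g (update p l x) ≠ g p
  · obtain ⟨p, l, x, h⟩ := hc
    -- Exchange coordinate `l` between `q` and `update p l x`: the latter becomes `p`, so the value
    -- `g p` must already occur in the old pair, and only `g q` can supply it.
    have slice : ∀ p x, g (update p l x) ≠ g p → ∀ q, q l = p l → g q = g p := by
      intro p x h q hq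
      have h2 := hg q (update p l x) l
      simp only [update_self, hq, update_idem, update_eq_self, Sym2.eq_iff] at h2
      rcases h2 with h2 | h2
      · exact absurd h2.2 h
      · exact h2.1
    -- Any `q` with another value is itself changed by a move along `l`, so `slice` applies at `q`
    -- as well.
    have leave : ∀ q, g q ≠ g p → g (update q l (p l)) ≠ g q := by
      intro q hq
      rw [slice p x h (update q l (p l)) (by simp)]
      exact hq.symm
    refine ⟨l, fun q q' e => ?_⟩
    by_cases h1 : g q = g p
    · by_cases h2 : g q' = g p
      · rw [h1, h2]
      · exact slice q' (p l) (leave q' h2) q e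
    · exact (slice q (p l) (leave q h1) q' e.symm).symm
  · push Not at hc
    exact ⟨Classical.arbitrary ι, fun p q _ => eq_of_update_eq hc p q⟩

/-- A permutation of a grid that respects swapping of coordinates up to order is a permutation of
the axes combined with a bijection of each axis. -/
theorem exists_axes_perm_of_swap [∀ l, Nontrivial (X l)] (φ : Equiv.Perm (∀ l, X l))
    (hφ : ∀ p q l i, s(φ p i, φ q i) =
      s(φ (update p l (q l)) i, φ (update q l (p l)) i)) :
    ∃ (τ : Equiv.Perm ι) (g : ∀ i, X (τ i) ≃ X i), ∀ p i, φ p i = g i (p (τ i)) := by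
  have h1 : ∀ i, ∃ l, ∀ p q, p l = q l → φ p i = φ q i := fun i =>
    haveI : Nonempty ι := ⟨i⟩
    exists_coordinate_of_swap (g := fun p => φ p i) fun p q l => hφ p q l i
  choose τ hτ using h1
  let o : ∀ l, X l := fun l => Classical.arbitrary _
  have hsurj : Surjective τ := by
    intro l
    by_contra! hl
    obtain ⟨x, hx⟩ := exists_ne (o l)
    have : φ (update o l x) = φ o := by
      funext i
      exact hτ i _ _ (by rw [update_of_ne (hl i)])
    exact hx (by simpa using congrFun (φ.injective this) l)
  have hbij : Bijective τ := Finite.surjective_iff_bijective.1 hsurj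
  have hg : ∀ i, Bijective fun x : X (τ i) => φ (update o (τ i) x) i := by
    intro i
    constructor
    · intro x y hxy
      have : φ (update o (τ i) x) = φ (update o (τ i) y) := by
        funext j
        by_cases hj : j = i
        · subst hj; exact hxy
        · have hne : τ j ≠ τ i := fun e => hj (hbij.1 e)
          exact hτ j _ _ (by rw [update_of_ne hne, update_of_ne hne])
      simpa using congrFun (φ.injective this) (τ i)
    · intro z
      obtain ⟨p, hp⟩ := φ.surjective (update o i z)
      refine ⟨p (τ i), ?_⟩
      have : φ (update o (τ i) (p (τ i))) i = φ p i := hτ i _ _ (by simp)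
      simp [this, hp]
  refine ⟨Equiv.ofBijective τ hbij, fun i => Equiv.ofBijective _ (hg i), fun p i => ?_⟩
  exact hτ i _ _ (by simp)

/-- If the products of two families over a grid agree, each factor of one is a multiple of the
corresponding factor of the other. -/
theorem eq_div_mul_of_prod_eq {K : Type*} [Field K] (τ : Equiv.Perm ι) {B : ∀ i, X i → K}
    {C : ∀ i, X (τ i) → K} (hB : ∀ i x, B i x ≠ 0) (hC : ∀ i x, C i x ≠ 0)
    (h : ∀ p : ∀ l, X l, ∏ l, B l (p l) = ∏ i, C i (p (τ i))) (o : ∀ l, X l) (i : ι)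
    (x : X (τ i)) : B (τ i) x = B (τ i) (o (τ i)) / C i (o (τ i)) * C i x := by
  -- All coordinates except `τ i` are frozen at `o`; the cases `y = x` and `y = o (τ i)` then
  -- eliminate the frozen products.
  have key : ∀ y, (B (τ i) y * ∏ j ∈ Finset.univ.erase i, B (τ j) (o (τ j))) =
      C i y * ∏ j ∈ Finset.univ.erase i, C j (o (τ j)) := by
    intro y
    have h2 := h (update o (τ i) y)
    rw [← Equiv.prod_comp τ, ← Finset.mul_prod_erase _ _ (Finset.mem_univ i),
      ← Finset.mul_prod_erase _ _ (Finset.mem_univ i), update_self] at h2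
    have hne : ∀ j ∈ Finset.univ.erase i, τ j ≠ τ i := fun j hj e =>
      Finset.ne_of_mem_erase hj (τ.injective e)
    have h3 : ∀ F : ∀ j, X (τ j) → K, ∏ j ∈ Finset.univ.erase i, F j (update o (τ i) y (τ j)) =
        ∏ j ∈ Finset.univ.erase i, F j (o (τ j)) := fun F =>
      Finset.prod_congr rfl fun j hj => by rw [update_of_ne (hne j hj)]
    rwa [h3 fun j => B (τ j), h3 C] at h2
  have hu : ∏ j ∈ Finset.univ.erase i, B (τ j) (o (τ j)) ≠ 0 :=
    Finset.prod_ne_zero_iff.2 fun j _ => hB _ _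
  have h1 := key x
  have h2 := key (o (τ i))
  have h3 := hC i (o (τ i))
  have h4 := hB (τ i) (o (τ i))
  have hv : ∏ j ∈ Finset.univ.erase i, C j (o (τ j)) ≠ 0 :=
    Finset.prod_ne_zero_iff.2 fun j _ => hC _ _
  generalize ∏ j ∈ Finset.univ.erase i, B (τ j) (o (τ j)) = u at *
  generalize ∏ j ∈ Finset.univ.erase i, C j (o (τ j)) = v at *
  field_simp
  apply mul_right_cancel₀ (mul_ne_zero hu hv)
  linear_combination C i (o (τ i)) * v * h1 - C i x * v * h2

end Grid

end HHD

namespace HHD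

/-! ### Segre variety and tensor rank -/

section Segre

variable {k : Type*} [Field k] {d : ℕ} {n : Fin d → ℕ}

theorem mul_mem_segre {A B : Tensor k n} (hA : A ∈ segre k n) (hB : B ∈ segre k n) :
    A * B ∈ segre k n := by
  obtain ⟨a, rfl⟩ := hA
  obtain ⟨b, rfl⟩ := hB
  exact ⟨fun l => a l * b l, by funext j; simp [outer, Finset.prod_mul_distrib]⟩

theorem inv_mem_segre {A : Tensor k n} (hA : A ∈ segre k n) : A⁻¹ ∈ segre k n := by
  obtain ⟨a, rfl⟩ := hA
  exact ⟨fun l => (a l)⁻¹, by funext j; simp [outer]⟩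

theorem one_mem_segre : (1 : Tensor k n) ∈ segre k n :=
  ⟨fun _ => 1, by funext j; simp [outer]⟩

theorem prod_mem_segre {ι : Type*} (s : Finset ι) (A : ι → Tensor k n)
    (hA : ∀ i ∈ s, A i ∈ segre k n) : ∏ i ∈ s, A i ∈ segre k n := by
  classical
  exact Finset.prod_induction A (· ∈ segre k n) (fun _ _ => mul_mem_segre) one_mem_segre hA

theorem const_mem_segre (hd : 0 < d) (c : k) : (fun _ => c : Tensor k n) ∈ segre k n :=
  ⟨fun l _ => if l = ⟨0, hd⟩ then c else 1, by funext j; simp [outer]⟩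

theorem zero_mem_segre (hd : 0 < d) : (0 : Tensor k n) ∈ segre k n :=
  const_mem_segre hd 0

theorem single_mem_segre (hd : 0 < d) (j : Idx n) (c : k) :
    (Pi.single j c : Tensor k n) ∈ segre k n := by
  have h : outer (n := n) (fun l => Pi.single (j l) (1 : k)) ∈ segre k n := ⟨_, rfl⟩
  convert mul_mem_segre (const_mem_segre hd c) h using 1
  funext i
  by_cases hij : i = j
  · subst hij; simp [outer]
  · obtain ⟨l, hl⟩ := Function.ne_iff.1 hij
    rw [Pi.single_eq_of_ne hij, Pi.mul_apply, outer,
      Finset.prod_eq_zero (Finset.mem_univ l) (Pi.single_eq_of_ne hl _), mul_zero]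

theorem IsNowhereZeroRankOne.div {D E : Tensor k n} (hD : IsNowhereZeroRankOne D)
    (hE : IsNowhereZeroRankOne E) : IsNowhereZeroRankOne (D / E) := by
  have h : ∀ j, (D / E) j ≠ 0 := fun j => div_ne_zero (hD.2 j) (hE.2 j)
  refine ⟨⟨?_, fun h0 => ?_⟩, h⟩
  · rw [div_eq_mul_inv]; exact mul_mem_segre hD.1.1 (inv_mem_segre hE.1.1)
  · obtain ⟨j, _⟩ := Function.ne_iff.1 hD.1.2
    exact h j (congrFun h0 j)

theorem sum_filter_ne_zero {M : Type*} [AddCommMonoid M] [DecidableEq M] (s : Multiset M) :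
    (s.filter (· ≠ 0)).sum = s.sum := by
  induction s using Multiset.induction_on with
  | empty => simp
  | cons a s ih => by_cases ha : a = 0 <;> simp [ha, ih]

/-- Counting only nonzero summands matters: when the rank equals the number of all summands, none of
them can be zero. -/
theorem tensorRank_sum_le [DecidableEq (Tensor k n)] (s : Multiset (Tensor k n))
    (hs : ∀ A ∈ s, A ∈ segre k n) : tensorRank s.sum ≤ (s.filter (· ≠ 0)).card := by
  refine Nat.sInf_le ⟨s.filter (· ≠ 0), rfl, fun A hA => ?_, ?_⟩
  · rw [Multiset.mem_filter] at hA
    exact ⟨hs A hA.1, hA.2⟩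
  · exact sum_filter_ne_zero s

theorem tensorRank_sum_le_card {ι : Type*} [Fintype ι] (A : ι → Tensor k n)
    (hA : ∀ i, A i ∈ segre k n) : tensorRank (∑ i, A i) ≤ Fintype.card ι := by
  classical
  refine (tensorRank_sum_le (Finset.univ.val.map A) (by simpa using hA)).trans ?_
  refine (Multiset.card_le_card (Multiset.filter_le _ _)).trans ?_
  rw [Multiset.card_map, Finset.card_val, Finset.card_univ]

theorem exists_multiset_card_eq_tensorRank (hd : 0 < d) (T : Tensor k n) :
    (cpds (tensorRank T) T).Nonempty := by
  classical
  -- Since `sInf ∅ = 0`, some decomposition must be exhibited: one summand per nonzero entry.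
  refine Nat.sInf_mem (s := {r | (cpds r T).Nonempty}) ?_
  let s : Multiset (Tensor k n) := Finset.univ.val.map fun j => Pi.single j (T j)
  refine ⟨_, s.filter (· ≠ 0), rfl, fun A hA => ?_, ?_⟩
  · rw [Multiset.mem_filter] at hA
    refine ⟨?_, hA.2⟩
    obtain ⟨j, _, rfl⟩ := Multiset.mem_map.1 hA.1
    exact single_mem_segre hd j _
  · have h : s.sum = T := Finset.univ_sum_single T
    rw [sum_filter_ne_zero, h]

theorem exists_map_univ_eq {α : Type*} {r : ℕ} (s : Multiset α) (hs : s.card = r) :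
    ∃ B : Fin r → α, (Finset.univ : Finset (Fin r)).val.map B = s := by
  obtain ⟨L, rfl⟩ := Quot.exists_rep s
  change L.length = r at hs
  subst hs
  exact ⟨L.get, by rw [Fin.univ_val_map, List.ofFn_get]; rfl⟩

theorem exists_equiv_of_map_univ_eq {α β γ : Type*} [Fintype α] [Fintype β] {f : α → γ}
    {g : β → γ} (h : (Finset.univ : Finset α).val.map f = (Finset.univ : Finset β).val.map g) :
    ∃ e : α ≃ β, ∀ a, f a = g (e a) := by
  classical
  have hc : ∀ c, Nonempty ({a // f a = c} ≃ {b // g b = c}) := by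
    intro c
    refine ⟨Fintype.equivOfCardEq ?_⟩
    have h1 := congrArg (Multiset.count c) h
    rw [Multiset.count_map, Multiset.count_map] at h1
    simp only [eq_comm (a := c)] at h1
    rw [Fintype.card_subtype, Fintype.card_subtype]
    exact h1
  exact ⟨Equiv.ofFiberEquiv fun c => (hc c).some, fun a => (Equiv.ofFiberEquiv_map _ a).symm⟩

/-- Tensors of rank at most `r` are the sums of `r` elements of the Segre variety. -/
theorem tensorRank_le_iff (hd : 0 < d) {r : ℕ} {T : Tensor k n} :
    tensorRank T ≤ r ↔ ∃ A : Fin r → Tensor k n, (∀ i, A i ∈ segre k n) ∧ ∑ i, A i = T := by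
  constructor
  · intro h
    obtain ⟨s, hs, hs1, hsum⟩ := exists_multiset_card_eq_tensorRank hd T
    obtain ⟨B, hB⟩ := exists_map_univ_eq (r := r)
      (s + Multiset.replicate (r - tensorRank T) (0 : Tensor k n)) (by simp [hs]; omega)
    refine ⟨B, fun i => ?_, ?_⟩
    · have : B i ∈ s + Multiset.replicate (r - tensorRank T) (0 : Tensor k n) := by
        rw [← hB]; exact Multiset.mem_map_of_mem B (Finset.mem_univ i)
      rcases Multiset.mem_add.1 this with h | h
      · exact (hs1 _ h).1
      · rw [Multiset.eq_of_mem_replicate h]; exact zero_mem_segre hd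
    · have := congrArg Multiset.sum hB
      rw [Multiset.sum_add, hsum, Multiset.sum_replicate, smul_zero, add_zero] at this
      exact this
  · rintro ⟨A, hA, rfl⟩
    simpa using tensorRank_sum_le_card A hA

/-- Exchanging a coordinate of two points does not change the product of the values. -/
theorem outer_mul_outer_update (a : (l : Fin d) → Fin (n l) → k) (i j : Idx n) (l : Fin d) :
    outer a (Function.update i l (j l)) * outer a (Function.update j l (i l)) =
      outer a i * outer a j := by
  simp only [outer, ← Finset.prod_mul_distrib]
  refine Finset.prod_congr rfl fun l' _ => ?_
  by_cases h : l' = l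
  · subst h; simp [mul_comm]
  · simp [h]

/-- The Segre variety is cut out by quadratic binomials. -/
theorem mem_segre_iff (hd : 0 < d) {A : Tensor k n} :
    A ∈ segre k n ↔ ∀ i j l,
      A (Function.update i l (j l)) * A (Function.update j l (i l)) = A i * A j := by
  constructor
  · rintro ⟨a, rfl⟩ i j l
    exact outer_mul_outer_update a i j l
  · intro h
    by_cases h0 : A = 0
    · rw [h0]; exact zero_mem_segre hd
    obtain ⟨o, ho⟩ := Function.ne_iff.1 h0
    replace ho : A o ≠ 0 := ho
    -- Walk from `o` to `j` one coordinate at a time. Exchanging coordinate `a` with `update o a (j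
    -- a)` turns that point back into `o`, so each move multiplies the entry by a ratio depending on
    -- `j a` alone.
    have key : ∀ (s : Finset (Fin d)) (j : Idx n), A (s.piecewise j o) =
        A o * ∏ l ∈ s, (A (Function.update o l (j l)) / A o) := by
      intro s j
      induction s using Finset.induction_on with
      | empty => simp
      | insert a s ha ih =>
        rw [Finset.prod_insert ha, Finset.piecewise_insert]
        have h1 := h (s.piecewise j o) (Function.update o a (j a)) a
        simp only [Function.update_self, Finset.piecewise_eq_of_notMem _ _ _ ha,
          Function.update_idem, Function.update_eq_self] at h1
        rw [ih] at h1
        apply mul_right_cancel₀ ho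
        rw [h1]
        field_simp
    have h2 : A = (fun _ => A o) * outer (fun l x => A (Function.update o l x) / A o) := by
      funext j
      have := key Finset.univ j
      rwa [Finset.piecewise_univ] at this
    rw [h2]
    exact mul_mem_segre (const_mem_segre hd _) ⟨_, rfl⟩

end Segre

/-! ### From R-identifiability to uniqueness of the HHD -/

section Identifiability

variable {k : Type*} [Field k] {d : ℕ} {n : Fin d → ℕ} {m : ℕ} {r : Fin m → ℕ}

/-- Two HHDs that differ by a permutation of the Hadamard factors and by scaling. -/
def AreEquivalent (r : Fin m → ℕ) (H H' : Fin m → Multiset (Tensor k n)) : Prop :=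
  ∃ (ψ : Equiv.Perm (Fin m)) (D : Fin m → Tensor k n),
    (∀ i, r (ψ i) = r i) ∧ (∀ i, IsNowhereZeroRankOne (D i)) ∧ ∏ i, D i = 1 ∧
    ∀ i, H' (ψ i) = (H i).map (fun A => D i * A)

/-- Quotients of the two scalings work. This supplies symmetry and transitivity at once, so
comparison with one fixed HHD suffices. -/
theorem AreEquivalent.of_common {H H' H'' : Fin m → Multiset (Tensor k n)}
    (h : AreEquivalent r H H') (h' : AreEquivalent r H H'') : AreEquivalent r H' H'' := by
  obtain ⟨ψ, D, hr, hD, hD1, hH⟩ := h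
  obtain ⟨ψ', D', hr', hD', hD1', hH'⟩ := h'
  refine ⟨ψ.symm.trans ψ', fun i => D' (ψ.symm i) / D (ψ.symm i), fun i => ?_,
    fun i => (hD' _).div (hD _), ?_, fun i => ?_⟩
  · simp [hr', ← hr (ψ.symm i)]
  · rw [Equiv.prod_comp ψ.symm fun i => D' i / D i, Finset.prod_div_distrib, hD1, hD1', div_one]
  · obtain ⟨i, rfl⟩ := ψ.surjective i
    simp only [Equiv.trans_apply, Equiv.symm_apply_apply, hH, hH', Multiset.map_map]
    refine Multiset.map_congr rfl fun A _ => ?_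
    funext j
    have := (hD i).2 j
    simp only [Function.comp, Pi.mul_apply, Pi.div_apply]
    field_simp

theorem isHHDIdentifiable_of_forall_areEquivalent {T : Tensor k n}
    {H : Fin m → Multiset (Tensor k n)} (hH : H ∈ hhds r T)
    (h : ∀ H' ∈ hhds r T, AreEquivalent r H H') : IsHHDIdentifiable r T := by
  have hc : ∀ H' ∈ hhds r T, essentialClass r T H' = hhds r T := fun H' hH' =>
    Set.Subset.antisymm (fun _ h => h.1) fun H'' hH'' =>
      ⟨hH'', (h H' hH').of_common (h H'' hH'')⟩
  refine ⟨hhds r T, Set.Subset.antisymm ?_ ?_⟩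
  · rintro _ ⟨H', hH', rfl⟩
    exact hc H' hH'
  · rintro _ rfl
    exact ⟨H, hH, hc H hH⟩

/-- Expanding an HHD of a tensor of the maximal possible rank gives a decomposition into rank-one
tensors. -/
theorem map_prod_mem_cpds {T : Tensor k n} (hT : tensorRank T = ∏ i, r i)
    (A : ∀ i, Fin (r i) → Tensor k n) (hA : ∀ i t, A i t ∈ segre k n)
    (h : T = ∏ i, ∑ t, A i t) :
    (Finset.univ : Finset (∀ i, Fin (r i))).val.map (fun p => ∏ i, A i (p i)) ∈
      cpds (∏ i, r i) T := by
  classical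
  set s := (Finset.univ : Finset (∀ i, Fin (r i))).val.map (fun p => ∏ i, A i (p i)) with hs
  have hcard : s.card = ∏ i, r i := by
    rw [hs, Multiset.card_map, Finset.card_val, Finset.card_univ, Fintype.card_pi]; simp
  have hsum : s.sum = T := by
    rw [h, Finset.prod_univ_sum, Fintype.piFinset_univ]; rfl
  have hseg : ∀ B ∈ s, B ∈ segre k n := by
    intro B hB
    obtain ⟨p, _, rfl⟩ := Multiset.mem_map.1 hB
    exact prod_mem_segre _ _ fun i _ => hA i _
  refine ⟨hcard, fun B hB => ⟨hseg B hB, ?_⟩, hsum⟩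
  have hle := tensorRank_sum_le s hseg
  rw [hsum, hT, ← hcard] at hle
  have := Multiset.eq_of_le_of_card_le (Multiset.filter_le (· ≠ 0) s) hle
  exact Multiset.filter_eq_self.1 this B hB

/-- An ordered HHD without zero entries whose products satisfy no quadratic binomial relations
besides the trivial ones. -/
def IsRelationFree (r : Fin m → ℕ) (x : OrderedIdx n r → k) : Prop :=
  (∀ c, x c ≠ 0) ∧ ∀ p q p' q' : ∀ i, Fin (r i),
    (∀ j, (∏ i, x (⟨i, p i⟩, j)) * ∏ i, x (⟨i, q i⟩, j) =
      (∏ i, x (⟨i, p' i⟩, j)) * ∏ i, x (⟨i, q' i⟩, j)) →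
    ∀ i, s(p i, q i) = s(p' i, q' i)

theorem isHHDIdentifiable_of_isRelationFree (hn : ∀ l, 0 < n l) (hr : ∀ i, 2 ≤ r i)
    {x : OrderedIdx n r → k} (hx : x ∈ orderedHHDs k n r) (hfree : IsRelationFree r x)
    (hid : IsIdentifiable (∏ i, r i) (hhdTensor r x)) : IsHHDIdentifiable r (hhdTensor r x) := by
  classical
  obtain ⟨hT, s, hs⟩ := hid
  let j₀ : Idx n := fun l => ⟨0, hn l⟩
  let A : ∀ i, Fin (r i) → Tensor k n := fun i t j => x (⟨i, t⟩, j)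
  have hA0 : ∀ i t j, A i t j ≠ 0 := fun i t j => hfree.1 _
  have hA : ∀ i t, A i t ∈ segre k n := fun i t => hx ⟨i, t⟩
  have hA1 : ∀ i t, IsRankOne (A i t) := fun i t =>
    ⟨hA i t, fun h => hA0 i t j₀ (congrFun h j₀)⟩
  have : ∀ i, Nontrivial (Fin (r i)) := fun i => Fin.nontrivial_iff_two_le.2 (hr i)
  let o : ∀ i, Fin (r i) := fun i => ⟨0, by have := hr i; omega⟩
  refine isHHDIdentifiable_of_forall_areEquivalent (H := fun i => Finset.univ.val.map (A i))
    ⟨fun i => ⟨by simp, by simpa using hA1 i⟩, rfl⟩ fun H hH => ?_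
  choose B hB using fun i => exists_map_univ_eq (H i) (hH.1 i).1
  have hB1 : ∀ i t, IsRankOne (B i t) := fun i t =>
    (hH.1 i).2 _ (by rw [← hB i]; exact Multiset.mem_map_of_mem _ (Finset.mem_univ t))
  have hBsum : hhdTensor r x = ∏ i, ∑ t, B i t := by
    rw [hH.2]
    exact Finset.prod_congr rfl fun i _ => by rw [← hB i]; rfl
  have hsA := map_prod_mem_cpds hT A hA rfl
  have hsB := map_prod_mem_cpds hT B (fun i t => (hB1 i t).1) hBsum
  rw [hs, Set.mem_singleton_iff] at hsA hsB
  obtain ⟨φ, hφ⟩ := exists_equiv_of_map_univ_eq (hsB.trans hsA.symm)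
  have hφ' : ∀ p j, ∏ i, B i (p i) j = ∏ i, A i (φ p i) j := fun p j => by
    simpa using congrFun (hφ p) j
  have hB0 : ∀ i t j, B i t j ≠ 0 := by
    intro i t j h
    have h1 := hφ' (Function.update o i t) j
    rw [Finset.prod_eq_zero (Finset.mem_univ i) (by simpa using h)] at h1
    exact Finset.prod_ne_zero_iff.2 (fun i _ => hA0 i _ j) h1.symm
  -- The exchange only commutes the two `l`-th factors of B; the resulting relation between products
  -- of A is trivial by relation-freeness.
  obtain ⟨τ, g, hg⟩ := exists_axes_perm_of_swap φ fun p q l i => by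
    refine hfree.2 _ _ _ _ (fun j => ?_) i
    have e1 := hφ' p j
    have e2 := hφ' q j
    have e3 := hφ' (Function.update p l (q l)) j
    have e4 := hφ' (Function.update q l (p l)) j
    change (∏ i, A i (φ p i) j) * (∏ i, A i (φ q i) j) = (∏ i, A i (φ _ i) j) * ∏ i, A i (φ _ i) j
    rw [← e1, ← e2, ← e3, ← e4, ← Finset.prod_mul_distrib, ← Finset.prod_mul_distrib]
    refine Finset.prod_congr rfl fun i _ => ?_
    by_cases h : i = l
    · subst h; simp [mul_comm]
    · simp [h]
  have hscale : ∀ i t, B (τ i) t =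
      (B (τ i) (o (τ i)) / A i (g i (o (τ i)))) * A i (g i t) := by
    intro i t
    funext j
    exact eq_div_mul_of_prod_eq τ (B := fun i t => B i t j) (C := fun i t => A i (g i t) j)
      (fun i t => hB0 i t j) (fun i t => hA0 i _ j) (fun p => by simp [hφ', hg]) o i t
  refine ⟨τ, fun i => B (τ i) (o (τ i)) / A i (g i (o (τ i))), fun i => ?_, fun i => ?_, ?_,
    fun i => ?_⟩
  · simpa using Fintype.card_congr (g i)
  · exact IsNowhereZeroRankOne.div ⟨hB1 _ _, hB0 _ _⟩ ⟨hA1 _ _, hA0 _ _⟩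
  · funext j
    have h1 := hφ' o j
    rw [← Equiv.prod_comp τ] at h1
    simp only [hg] at h1
    have h2 : ∏ i, A i (g i (o (τ i))) j ≠ 0 := Finset.prod_ne_zero_iff.2 fun i _ => hA0 i _ j
    rw [Finset.prod_apply]
    simp only [Pi.div_apply, Pi.one_apply]
    rw [Finset.prod_div_distrib, h1, div_self h2]
  · rw [← hB (τ i), Multiset.map_map, Multiset.map_congr rfl fun t _ => hscale i t,
      ← Multiset.map_univ_val_equiv (g i), Multiset.map_map]
    rfl

end Identifiability

end HHD

namespace HHD

/-! ### Generic points and images of polynomial maps -/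

section Zariski

open MvPolynomial

variable {k : Type*} [Field k]

theorem isZariskiClosed_zariskiClosure {ι : Type*} (V : Set (ι → k)) :
    IsZariskiClosed (zariskiClosure V) :=
  ⟨_, rfl⟩

theorem subset_zariskiClosure {ι : Type*} (V : Set (ι → k)) : V ⊆ zariskiClosure V :=
  zeroLocus_vanishingIdeal_le V

/-- A property that holds on a closed set off a hypersurface not containing it is generic. -/
theorem generically_of_aeval_ne_zero {ι : Type*} {V : Set (ι → k)} {P : (ι → k) → Prop}
    (hV : IsZariskiClosed V) (f : MvPolynomial ι k) {x₀ : ι → k} (hx₀ : x₀ ∈ V)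
    (hf : aeval x₀ f ≠ 0) (h : ∀ x ∈ V, aeval x f ≠ 0 → P x) : Generically V P := by
  obtain ⟨I, rfl⟩ := hV
  have hmem : ∀ x, x ∈ zeroLocus k (I ⊔ Ideal.span {f}) ↔ x ∈ zeroLocus k I ∧ aeval x f = 0 := by
    intro x
    constructor
    · intro hx
      exact ⟨zeroLocus_anti_mono le_sup_left hx,
        hx f (Ideal.mem_sup_right (Ideal.mem_span_singleton_self f))⟩
    · rintro ⟨hx, hxf⟩ p hp
      obtain ⟨a, ha, b, hb, rfl⟩ := Submodule.mem_sup.1 hp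
      obtain ⟨c, rfl⟩ := Ideal.mem_span_singleton.1 hb
      rw [map_add, map_mul, hxf, hx a ha, zero_mul, add_zero]
  refine ⟨zeroLocus k (I ⊔ Ideal.span {f}), ⟨_, rfl⟩,
    ⟨fun x hx => ((hmem x).1 hx).1, fun hsub => ?_⟩,
    fun x hx => h x hx.1 fun h0 => hx.2 ((hmem x).2 ⟨hx.1, h0⟩)⟩
  exact hf ((hmem x₀).1 (hsub hx₀)).2

/-- The ideal of the image of a polynomial map is the kernel of the substitution. -/
theorem mem_vanishingIdeal_range_iff [Infinite k] {σ τ : Type*} (θ : τ → MvPolynomial σ k)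
    (a : MvPolynomial τ k) :
    a ∈ vanishingIdeal k (Set.range fun (x : σ → k) j => aeval x (θ j)) ↔ bind₁ θ a = 0 := by
  constructor
  · intro h
    refine MvPolynomial.funext fun x => ?_
    have := h _ ⟨x, rfl⟩
    rw [← aeval_bind₁] at this
    simpa [aeval_eq_eval] using this
  · rintro h _ ⟨x, rfl⟩
    rw [← aeval_bind₁, h, map_zero]

/-- Needed for Chevalley's theorem. The source is noetherian, so finite type is enough, and this is
inherited from `k`. -/
theorem finitePresentation_bind₁ {σ τ : Type*} [Finite σ] [Finite τ]
    (θ : τ → MvPolynomial σ k) :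
    (bind₁ θ : MvPolynomial τ k →ₐ[k] _).toRingHom.FinitePresentation := by
  rw [← RingHom.FinitePresentation.of_finiteType]
  refine RingHom.FiniteType.of_comp_finiteType (f := (C : k →+* MvPolynomial τ k)) ?_
  have : (bind₁ θ : MvPolynomial τ k →ₐ[k] _).toRingHom.comp C =
      algebraMap k (MvPolynomial σ k) := by
    ext; simp [algebraMap_eq]
  rw [this, RingHom.finiteType_algebraMap]
  infer_instance

/-- The image of a nonempty basic open set under a polynomial map of affine spaces contains a
nonempty basic open subset of the closure of the image of the map. -/
theorem exists_basicOpen_subset_image [IsAlgClosed k] {σ τ : Type*} [Finite σ] [Finite τ]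
    (θ : τ → MvPolynomial σ k) {g : MvPolynomial σ k} (hg : g ≠ 0) :
    ∃ a : MvPolynomial τ k, bind₁ θ a ≠ 0 ∧
      ∀ y ∈ zariskiClosure (Set.range fun (x : σ → k) j => aeval x (θ j)), aeval y a ≠ 0 →
        ∃ x : σ → k, aeval x g ≠ 0 ∧ (fun j => aeval x (θ j)) = y := by
  have : Infinite k := IsAlgClosed.instInfinite
  let Θ := (bind₁ θ : MvPolynomial τ k →ₐ[k] _).toRingHom
  obtain ⟨S, hS⟩ := PrimeSpectrum.exists_constructibleSetData_iff.2
    (PrimeSpectrum.isConstructible_comap_image (finitePresentation_bind₁ θ)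
      (PrimeSpectrum.isConstructible_basicOpen (f := g)))
  -- The generic point lies in the basic open set of `g`. The equations of the constructible piece
  -- containing its image pull back to zero, so they hold on the whole closure; only the inequation
  -- `C.f ≠ 0` remains.
  let η : PrimeSpectrum (MvPolynomial σ k) := ⟨⊥, Ideal.isPrime_bot⟩
  have hη : PrimeSpectrum.comap Θ η ∈ S.toSet := by
    rw [hS]
    exact ⟨η, by simpa [η] using hg, rfl⟩
  obtain ⟨C, hC, hηC⟩ := Set.mem_iUnion₂.1 hη
  have hCg : ∀ i, bind₁ θ (C.g i) = 0 := fun i => by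
    have := hηC.1 ⟨i, rfl⟩
    simpa [η, Θ] using this
  refine ⟨C.f, fun h => hηC.2 ?_, fun y hy hyC => ?_⟩
  · rintro _ rfl
    simpa [η, Θ] using h
  · have hyS : (⟨vanishingIdeal k {y}, inferInstance⟩ : PrimeSpectrum (MvPolynomial τ k)) ∈
        S.toSet := by
      refine Set.mem_iUnion₂.2 ⟨C, hC, ?_, fun h => hyC ?_⟩
      · rintro _ ⟨i, rfl⟩
        rw [SetLike.mem_coe, mem_vanishingIdeal_singleton_iff]
        exact hy _ ((mem_vanishingIdeal_range_iff θ _).2 (hCg i))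
      · exact (mem_vanishingIdeal_singleton_iff _ _).1 (h rfl)
    rw [hS] at hyS
    obtain ⟨q, hgq, hq⟩ := hyS
    -- Chevalley gives only a prime `q` over `y`; by the Nullstellensatz, the zero locus of `q` has
    -- a rational point where `g` is nonzero, and it still maps to `y`.
    have hrad := q.isPrime.radical
    rw [← vanishingIdeal_zeroLocus_eq_radical (K := k)] at hrad
    have hgq' : g ∉ vanishingIdeal k (zeroLocus k q.asIdeal) := by
      rw [hrad]; exact hgq
    simp only [mem_vanishingIdeal_iff, not_forall] at hgq'
    obtain ⟨x, hx, hxg⟩ := hgq'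
    refine ⟨x, hxg, funext fun j => ?_⟩
    have hj : (X j - MvPolynomial.C (y j) : MvPolynomial τ k) ∈
        (PrimeSpectrum.comap Θ q).asIdeal := by
      rw [hq, mem_vanishingIdeal_singleton_iff]
      simp
    have := hx _ hj
    simpa [Θ, sub_eq_zero] using this

end Zariski

end HHD

namespace HHD

/-! ### Generic relation-freeness and parametrizations -/

section Genericity

open MvPolynomial

variable {k : Type*} [Field k] {d : ℕ} {n : Fin d → ℕ} {m : ℕ} {r : Fin m → ℕ}

theorem isZariskiClosed_orderedHHDs (hd : 0 < d) : IsZariskiClosed (orderedHHDs k n r) := by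
  refine ⟨Ideal.span (Set.range fun c : ((i : Fin m) × Fin (r i)) × Idx n × Idx n × Fin d =>
    (X (c.1, Function.update c.2.1 c.2.2.2 (c.2.2.1 c.2.2.2)) *
      X (c.1, Function.update c.2.2.1 c.2.2.2 (c.2.1 c.2.2.2)) -
        X (c.1, c.2.1) * X (c.1, c.2.2.1) : MvPolynomial (OrderedIdx n r) k)), ?_⟩
  ext x
  simp only [zeroLocus_span, Set.forall_mem_range, orderedHHDs, Set.mem_ofPred_eq,
    mem_segre_iff hd, map_sub, map_mul, aeval_X, sub_eq_zero, Prod.forall]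

/-- Products over a grid of distinct primes satisfy only the trivial quadratic relations. -/
theorem sym2_eq_of_prod_primes_eq {c : (i : Fin m) × Fin (r i) → ℕ} (hc : ∀ a, (c a).Prime)
    (hinj : Function.Injective c) {p q p' q' : ∀ i, Fin (r i)}
    (h : (∏ i, c ⟨i, p i⟩) * ∏ i, c ⟨i, q i⟩ = (∏ i, c ⟨i, p' i⟩) * ∏ i, c ⟨i, q' i⟩)
    (i : Fin m) : s(p i, q i) = s(p' i, q' i) := by
  have hne : ∀ u : ∀ i, Fin (r i), ∏ i, c ⟨i, u i⟩ ≠ 0 := fun u =>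
    Finset.prod_ne_zero_iff.2 fun i _ => (hc _).ne_zero
  have hfac : ∀ (u : ∀ i, Fin (r i)) (t : Fin (r i)),
      (∏ i, c ⟨i, u i⟩).factorization (c ⟨i, t⟩) = if u i = t then 1 else 0 := by
    intro u t
    rw [Nat.factorization_prod fun i _ => (hc _).ne_zero, Finsupp.finsetSum_apply,
      Finset.sum_eq_single i]
    · rw [(hc _).factorization, Finsupp.single_apply]
      simp [hinj.eq_iff]
    · intro b _ hb
      rw [(hc _).factorization, Finsupp.single_apply, if_neg]
      exact fun e => hb (congrArg Sigma.fst (hinj e))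
    · simp
  -- The exponent of the prime attached to `(i, t)` counts how often `t` occurs in the pair at `i`.
  have key : ∀ t : Fin (r i), ((if p i = t then 1 else 0) + if q i = t then 1 else 0) =
      ((if p' i = t then 1 else 0) + if q' i = t then 1 else 0 : ℕ) := by
    intro t
    have h1 := congrArg (fun N : ℕ => N.factorization (c ⟨i, t⟩)) h
    simpa [Nat.factorization_mul (hne _) (hne _), hfac] using h1
  have h1 := key (p i)
  have h2 := key (q i)
  rw [Sym2.eq_iff]
  grind

/-- Ordered HHDs are generically relation free. -/
theorem exists_aeval_ne_zero_imp_isRelationFree [CharZero k] (hd : 0 < d) (hn : ∀ l, 0 < n l) :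
    ∃ f : MvPolynomial (OrderedIdx n r) k, (∃ x ∈ orderedHHDs k n r, aeval x f ≠ 0) ∧
      ∀ x : OrderedIdx n r → k, aeval x f ≠ 0 → IsRelationFree r x := by
  classical
  let j₀ : Idx n := fun l => ⟨0, hn l⟩
  let G := ∀ i, Fin (r i)
  -- A relation between tensors holds in particular at entry `j₀`, so excluding it there is enough.
  let M : G → MvPolynomial (OrderedIdx n r) k := fun p => ∏ i, X (⟨i, p i⟩, j₀)
  have hM : ∀ (x : OrderedIdx n r → k) p, aeval x (M p) = ∏ i, x (⟨i, p i⟩, j₀) := fun x p => by simp [M]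
  let bad : Finset (G × G × G × G) := Finset.univ.filter fun w =>
    ¬ ∀ i, s(w.1 i, w.2.1 i) = s(w.2.2.1 i, w.2.2.2 i)
  refine ⟨(∏ c, X c) * ∏ w ∈ bad, (M w.1 * M w.2.1 - M w.2.2.1 * M w.2.2.2), ?_, fun x hx => ?_⟩
  · let e := Fintype.equivFin ((i : Fin m) × Fin (r i))
    let c : (i : Fin m) × Fin (r i) → ℕ := fun a => Nat.nth Nat.Prime (e a)
    have hc : ∀ a, (c a).Prime := fun a => Nat.prime_nth_prime _
    have hinj : Function.Injective c := fun a b h =>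
      e.injective (Fin.ext (Nat.nth_injective Nat.infinite_setOfPred_prime h))
    refine ⟨fun a => (c a.1 : k), fun a => const_mem_segre hd (c a : k), ?_⟩
    rw [map_mul, map_prod, map_prod]
    refine mul_ne_zero (Finset.prod_ne_zero_iff.2 fun a _ => ?_)
      (Finset.prod_ne_zero_iff.2 fun w hw h => (Finset.mem_filter.1 hw).2 ?_)
    · simpa using (hc a.1).ne_zero
    · simp only [map_sub, map_mul, hM, sub_eq_zero] at h
      exact sym2_eq_of_prod_primes_eq hc hinj (by exact_mod_cast h)
  · rw [map_mul, map_prod, map_prod] at hx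
    refine ⟨fun c => ?_, fun p q p' q' h => ?_⟩
    · simpa using Finset.prod_ne_zero_iff.1 (left_ne_zero_of_mul hx) c (Finset.mem_univ c)
    · by_contra hne
      have hw : (p, q, p', q') ∈ bad := Finset.mem_filter.2 ⟨Finset.mem_univ _, hne⟩
      apply Finset.prod_ne_zero_iff.1 (right_ne_zero_of_mul hx) _ hw
      simp only [map_sub, map_mul, hM, sub_eq_zero]
      exact h j₀

theorem openHadamardSecant_eq_image (hd : 0 < d) :
    openHadamardSecant k n r = hhdTensor r '' orderedHHDs k n r := by
  ext T
  constructor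
  · rintro ⟨Y, hY, rfl⟩
    choose A hA hsum using fun i => (tensorRank_le_iff hd).1 (hY i)
    exact ⟨fun c => A c.1.1 c.1.2 c.2, fun p => hA p.1 p.2,
      Finset.prod_congr rfl fun i _ => hsum i⟩
  · rintro ⟨x, hx, rfl⟩
    exact ⟨_, fun i => (tensorRank_le_iff hd).2 ⟨_, fun t => hx ⟨i, t⟩, rfl⟩, rfl⟩

/-- Coordinates of the vectors whose tensor products are the summands of an ordered HHD. -/
abbrev FactorIdx {d m : ℕ} (n : Fin d → ℕ) (r : Fin m → ℕ) : Type :=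
  ((i : Fin m) × Fin (r i)) × ((l : Fin d) × Fin (n l))

variable (k) in
/-- The entries of the summands of an ordered HHD as polynomials in the entries of the vectors. -/
noncomputable def summandPoly (n : Fin d → ℕ) (r : Fin m → ℕ) (c : OrderedIdx n r) :
    MvPolynomial (FactorIdx n r) k :=
  ∏ l, X (c.1, ⟨l, c.2 l⟩)

/-- With affine space as source, the coordinate ring is a polynomial ring, hence a domain with a
generic point. -/
theorem orderedHHDs_eq_range :
    orderedHHDs k n r =
      Set.range fun (y : FactorIdx n r → k) c => aeval y (summandPoly k n r c) := by
  ext x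
  constructor
  · intro hx
    choose a ha using hx
    refine ⟨fun c => a c.1 c.2.1 c.2.2, funext fun c => ?_⟩
    rw [← congrFun (ha c.1) c.2]
    simp [summandPoly, outer]
  · rintro ⟨y, rfl⟩ p
    exact ⟨fun l t => y (p, ⟨l, t⟩), funext fun j => by simp [summandPoly, outer]⟩

variable (k) in
/-- The entries of the tensor of an ordered HHD as polynomials in the entries of the vectors. -/
noncomputable def hhdPoly (n : Fin d → ℕ) (r : Fin m → ℕ) (j : Idx n) :
    MvPolynomial (FactorIdx n r) k :=
  ∏ i, ∑ t : Fin (r i), summandPoly k n r (⟨i, t⟩, j)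

theorem aeval_hhdPoly (y : FactorIdx n r → k) :
    (fun j => aeval y (hhdPoly k n r j)) =
      hhdTensor r fun c => aeval y (summandPoly k n r c) := by
  funext j
  simp [hhdPoly, hhdTensor]

theorem openHadamardSecant_eq_range (hd : 0 < d) :
    openHadamardSecant k n r =
      Set.range fun (y : FactorIdx n r → k) j => aeval y (hhdPoly k n r j) := by
  rw [openHadamardSecant_eq_image hd, orderedHHDs_eq_range, ← Set.range_comp]
  exact congrArg Set.range (funext fun y => (aeval_hhdPoly y).symm)

end Genericity

end HHD

/-! ### Proof of (a) and (b) -/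

theorem mainTheorem1 {k : Type*} [Field k] [CharZero k] {d m : ℕ} (hd : 0 < d)
    (n : Fin d → ℕ) (hn : ∀ l, 0 < n l) (r : Fin m → ℕ) (hr : ∀ i, 2 ≤ r i) :
    HHD.Generically (HHD.orderedHHDs k n r) (fun x =>
      HHD.IsIdentifiable (∏ i, r i) (HHD.hhdTensor r x) →
        HHD.IsHHDIdentifiable r (HHD.hhdTensor r x)) ∧
    (IsAlgClosed k →
      HHD.Generically (HHD.hadamardSecant k n r) (fun T =>
        HHD.IsIdentifiable (∏ i, r i) T → HHD.IsHHDIdentifiable r T)) := by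
  obtain ⟨f, ⟨x₀, hx₀, hfx₀⟩, hf⟩ :=
    HHD.exists_aeval_ne_zero_imp_isRelationFree (k := k) (r := r) hd hn
  refine ⟨HHD.generically_of_aeval_ne_zero (HHD.isZariskiClosed_orderedHHDs hd) f hx₀ hfx₀
    fun x hx hfx => HHD.isHHDIdentifiable_of_isRelationFree hn hr hx (hf x hfx), fun _ => ?_⟩
  have hg : MvPolynomial.bind₁ (HHD.summandPoly k n r) f ≠ 0 := by
    rw [HHD.orderedHHDs_eq_range] at hx₀
    obtain ⟨y, rfl⟩ := hx₀
    intro h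
    rw [← MvPolynomial.aeval_bind₁, h, map_zero] at hfx₀
    exact hfx₀ rfl
  obtain ⟨a, ha, himage⟩ := HHD.exists_basicOpen_subset_image (HHD.hhdPoly k n r) hg
  -- A nonzero pullback means that `a` is nonzero at some `T₀` in the image, so the exceptional set
  -- is proper.
  rw [Ne, ← HHD.mem_vanishingIdeal_range_iff] at ha
  simp only [MvPolynomial.mem_vanishingIdeal_iff, not_forall] at ha
  obtain ⟨T₀, hT₀, haT₀⟩ := ha
  rw [← HHD.openHadamardSecant_eq_range hd] at hT₀ himage
  refine HHD.generically_of_aeval_ne_zero (HHD.isZariskiClosed_zariskiClosure _) a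
    (HHD.subset_zariskiClosure _ hT₀) haT₀ fun T hT haT => ?_
  obtain ⟨y, hy, rfl⟩ := himage T hT haT
  rw [MvPolynomial.aeval_bind₁] at hy
  rw [HHD.aeval_hhdPoly]
  refine HHD.isHHDIdentifiable_of_isRelationFree hn hr ?_ (hf _ hy)
  rw [HHD.orderedHHDs_eq_range]
  exact ⟨y, rfl⟩
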